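/- Let $\gamma$ be Euler's constant, let $\ln w$ for complex $w\neq 0$ be the principal logarithm ($-\pi<\operatorname{Im}\ln w\le\pi$) and $w^\beta=e^{\beta\ln w}$, and let $\ln\Gamma$ denote the holomorphic logarithm of the Gamma function on the half-plane $\operatorname{Re} z>0$ that is real for $z>0$ (equivalently, that vanishes at $z=1$). Then for every $\beta\in\mathbb{C}$ with $\operatorname{Re}\beta>-1$ the following integral converges absolutely and $$\frac{1}{2i}\int_{-\pi/2}^{\pi/2}\frac{x\,(1+e^{-2ix})^{\beta}}{\ln(1+e^{-2ix})}\,dx=\frac{\pi}{8}\Bigl(1+\ln 2\pi-\gamma(2\beta+1)-2\ln\Gamma(\beta+1)\Bigr).$$ Moreover, for $\beta=0$, $$\frac{1}{2i}\int_{-\pi/2}^{\pi/2}\frac{x}{\ln(1+e^{-2ix})}\,dx=\int_0^{\pi/2}\frac{x^2}{x^2+\ln^2(2\cos x)}\,dx,$$ the integral on the right converges, and one obtains the Glasser–Manna–Oloa integral $$\frac{4}{\pi}\int_0^{\pi/2}\frac{x^2}{x^2+\ln^2(2\cos x)}\,dx=\frac12\bigl(1-\gamma+\ln 2\pi\bigr).$$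 -/

import Mathlib

/-- On the open right half-plane `Γ` has a holomorphic logarithm that vanishes at `1`. -/
theorem exists_logGamma : ∃ L : ℂ → ℂ, DifferentiableOn ℂ L {z : ℂ | 0 < z.re} ∧
    (∀ z : ℂ, 0 < z.re → Complex.exp (L z) = Complex.Gamma z) ∧ L 1 = 0 := by
  have hconv : Convex ℝ {z : ℂ | 0 < z.re} := convex_halfSpace_re_gt 0
  have hne : ({z : ℂ | 0 < z.re}).Nonempty := ⟨1, by simp⟩
  have hopen : IsOpen {z : ℂ | 0 < z.re} := isOpen_lt continuous_const Complex.continuous_re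
  have hsc : IsSimplyConnected {z : ℂ | 0 < z.re} := by
    have := hconv.contractibleSpace hne
    exact (inferInstance : SimplyConnectedSpace {z : ℂ | 0 < z.re})
  have hd : ∀ z : ℂ, 0 < z.re → DifferentiableAt ℂ Complex.Gamma z := fun z hz =>
    Complex.differentiableAt_Gamma z (fun m h => by
      have h2 : z.re = -(m : ℝ) := by simp [h]
      have := Nat.cast_nonneg (α := ℝ) m
      linarith)
  obtain ⟨f, hfc, hf⟩ := Complex.exists_continuousOn_eqOn_exp_comp hsc hopen
    (g := Complex.Gamma) (fun z hz => (hd z hz).continuousAt.continuousWithinAt)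
    (fun ⟨z, hz, h⟩ => Complex.Gamma_ne_zero_of_re_pos hz h)
  have hf' : ∀ z : ℂ, 0 < z.re → Complex.exp (f z) = Complex.Gamma z := fun z hz => hf hz
  refine ⟨fun z => f z - f 1, ?_, ?_, by simp⟩
  · intro z hz
    refine (DifferentiableAt.sub_const ?_ _).differentiableWithinAt
    have hz' : 0 < z.re := hz
    have hcont : ContinuousAt f z := hfc.continuousAt (hopen.mem_nhds hz)
    have hloc : ∀ᶠ w in nhds z,
        f w = Complex.log (Complex.Gamma w / Complex.Gamma z) + f z := by
      filter_upwards [hopen.mem_nhds hz, hcont (Metric.ball_mem_nhds (f z) Real.pi_pos)]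
        with w hw hb
      have hw' : 0 < w.re := hw
      have hb' : ‖f w - f z‖ < Real.pi := by
        rw [← dist_eq_norm]; exact hb
      have him := abs_lt.mp (lt_of_le_of_lt (Complex.abs_im_le_norm _) hb')
      rw [← hf' w hw', ← hf' z hz', ← Complex.exp_sub,
        Complex.log_exp him.1 him.2.le]
      ring
    refine DifferentiableAt.congr_of_eventuallyEq ?_ hloc
    refine DifferentiableAt.add_const _ (DifferentiableAt.clog ((hd z hz').div_const _) ?_)
    rw [div_self (Complex.Gamma_ne_zero_of_re_pos hz')]
    exact Complex.one_mem_slitPlane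
  · intro z hz
    rw [Complex.exp_sub, hf' z hz, hf' 1 (by simp), Complex.Gamma_one, div_one]

/-- The holomorphic logarithm of `Γ` on the half-plane `Re z > 0`, normalised by the value `0` at
`z = 1`; equivalently, the analytic continuation of the real function `ln Γ(x)`, `x > 0`. (It is in
general not the principal logarithm of `Γ z`.) Values outside the half-plane carry no meaning. -/
noncomputable def logGamma : ℂ → ℂ := exists_logGamma.choose

theorem logGamma_differentiableOn : DifferentiableOn ℂ logGamma {z : ℂ | 0 < z.re} :=
  exists_logGamma.choose_spec.1

theorem exp_logGamma {z : ℂ} (hz : 0 < z.re) :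
    Complex.exp (logGamma z) = Complex.Gamma z :=
  exists_logGamma.choose_spec.2.1 z hz

theorem logGamma_one : logGamma 1 = 0 := exists_logGamma.choose_spec.2.2

/-- `logGamma` is pinned down on the half-plane by its three defining properties, with continuity
in place of holomorphy. -/
theorem logGamma_unique {L : ℂ → ℂ} (hL : ContinuousOn L {z : ℂ | 0 < z.re})
    (hexp : ∀ z : ℂ, 0 < z.re → Complex.exp (L z) = Complex.Gamma z) (h1 : L 1 = 0)
    {z : ℂ} (hz : 0 < z.re) : L z = logGamma z := by
  have hpre : IsPreconnected {z : ℂ | 0 < z.re} := (convex_halfSpace_re_gt 0).isPreconnected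
  have hpi : (2 * (Real.pi : ℂ) * Complex.I) ≠ 0 := Complex.two_pi_I_ne_zero
  have hint : ∀ w : ℂ, 0 < w.re →
      ∃ n : ℤ, ((L w - logGamma w) / (2 * Real.pi * Complex.I)).re = n ∧
        L w = logGamma w + n * (2 * Real.pi * Complex.I) := by
    intro w hw
    obtain ⟨n, hn⟩ := Complex.exp_eq_exp_iff_exists_int.mp
      ((hexp w hw).trans (exp_logGamma hw).symm)
    refine ⟨n, ?_, hn⟩
    rw [hn, add_sub_cancel_left, mul_div_assoc, div_self hpi]
    simp
  have hc : ContinuousOn (fun w : ℂ => ((L w - logGamma w) / (2 * Real.pi * Complex.I)).re)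
      {z : ℂ | 0 < z.re} :=
    Complex.continuous_re.comp_continuousOn
      ((hL.sub logGamma_differentiableOn.continuousOn).div_const _)
  have hmaps : Set.MapsTo (fun w : ℂ => ((L w - logGamma w) / (2 * Real.pi * Complex.I)).re)
      {z : ℂ | 0 < z.re} (Set.range ((↑) : ℤ → ℝ)) := by
    intro w hw
    obtain ⟨n, hn, -⟩ := hint w hw
    exact ⟨n, hn.symm⟩
  have hconst : ((L z - logGamma z) / (2 * Real.pi * Complex.I)).re
      = ((L 1 - logGamma 1) / (2 * Real.pi * Complex.I)).re := by
    have hdisc : IsDiscrete (Set.range ((↑) : ℤ → ℝ)) :=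
      ⟨Int.isClosedEmbedding_coe_real.isEmbedding.toHomeomorph.symm.isEmbedding.discreteTopology⟩
    have h1mem : (1 : ℂ) ∈ {z : ℂ | 0 < z.re} := by simp
    exact hpre.constant_of_mapsTo hdisc hc hmaps hz h1mem
  obtain ⟨n, hn, hn'⟩ := hint z hz
  rw [h1, logGamma_one] at hconst
  have hn0 : (n : ℝ) = 0 := by rw [← hn, hconst]; simp
  have hn1 : n = 0 := by exact_mod_cast hn0
  rw [hn', hn1]; simp

/-- On the positive reals `logGamma` is the real logarithm of the real Gamma function. -/
theorem logGamma_ofReal {x : ℝ} (hx : 0 < x) :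
    logGamma (x : ℂ) = (Real.log (Real.Gamma x) : ℂ) := by
  have hcj : ∀ z : ℂ, 0 < z.re → (starRingEnd ℂ) (logGamma ((starRingEnd ℂ) z)) = logGamma z := by
    intro z hz
    refine logGamma_unique (L := fun z => (starRingEnd ℂ) (logGamma ((starRingEnd ℂ) z)))
      ?_ ?_ ?_ hz
    · exact Complex.continuous_conj.comp_continuousOn
        (logGamma_differentiableOn.continuousOn.comp Complex.continuous_conj.continuousOn
          (fun w hw => by simpa using hw))
    · intro w hw
      simp only [Complex.exp_conj]
      rw [exp_logGamma (by simpa using hw), Complex.Gamma_conj, Complex.conj_conj]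
    · simp [logGamma_one]
  have h := hcj x (by simpa using hx)
  rw [Complex.conj_ofReal] at h
  obtain ⟨r, hr⟩ := Complex.conj_eq_iff_real.mp h
  have he := exp_logGamma (z := (x : ℂ)) (by simpa using hx)
  rw [hr, Complex.Gamma_ofReal] at he
  have he' : Real.exp r = Real.Gamma x := by exact_mod_cast he
  rw [hr, ← he', Real.log_exp]

/-! Write w = e^{-2ix}, so that 1 + w = 2 cos x · e^{-ix} and 2ix = log(1 + w̄) - log(1 + w) for |x|
< π/2. Expressing each logarithm as an integral over u in [0,1] and exchanging integrals turns the
moment of x(1+w)^s into circle averages, which the mean value property and Cauchy's formula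
evaluate; the result is the generalised harmonic number H(s)
(`integral_mul_one_add_circlePoint_cpow`). An integration by parts inserts a factor w̄
(`integral_mul_circlePoint_neg_mul_cpow`).

The logarithm in the denominator then comes from integrating in the exponent: the integral of
w̄(1+w)^s over s in [b, b+1] is (1+w)^b / log(1+w), because (1+w)^{b+1} - (1+w)^b = w(1+w)^b and w̄w
= 1. What remains is the integral of sH(s) - s - 1 over [b, b+1]. It follows from H(s) = ψ(s+1) + γ
(`harmonicIntegral_eq`) and Raabe's formula (`integral_log_Gamma`).

The exchanges of integrals are made for real b ≥ 1, where the integrands are bounded; the identity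
theorem extends the formula to Re β > -1. For β = 0, pairing x with -x gives the Glasser–Manna–Oloa
integrand. -/

/-! ### The boundary function 1 + e^{-2ix} and its logarithm -/

/-- The point `exp (-2 i x)` of the unit circle. -/
noncomputable def circlePoint (x : ℝ) : ℂ := Complex.exp (-2 * Complex.I * x)

theorem norm_circlePoint (x : ℝ) : ‖circlePoint x‖ = 1 := by
  rw [circlePoint, Complex.norm_exp]; simp

theorem continuous_circlePoint : Continuous circlePoint := by
  unfold circlePoint; fun_prop

theorem circlePoint_re (x : ℝ) : (circlePoint x).re = Real.cos (2 * x) := by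
  rw [circlePoint, Complex.exp_re]; simp

theorem circlePoint_mul_neg (x : ℝ) : circlePoint (-x) * circlePoint x = 1 := by
  rw [circlePoint, circlePoint, ← Complex.exp_add]; simp

theorem hasDerivAt_circlePoint (x : ℝ) :
    HasDerivAt circlePoint (-2 * Complex.I * circlePoint x) x := by
  have h : HasDerivAt (fun y : ℝ => -2 * Complex.I * (y : ℂ)) (-2 * Complex.I) x := by
    simpa using (Complex.ofRealCLM.hasDerivAt (x := x)).const_mul (-2 * Complex.I)
  have h2 := h.cexp
  rw [mul_comm (Complex.exp _)] at h2
  exact h2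

theorem one_add_circlePoint (x : ℝ) :
    1 + circlePoint x = ((2 * Real.cos x : ℝ) : ℂ) * Complex.exp (((-x : ℝ) : ℂ) * Complex.I) := by
  have h : circlePoint x = Complex.exp (-(x * Complex.I)) * Complex.exp (-(x * Complex.I)) := by
    rw [circlePoint, ← Complex.exp_add]; congr 1; ring
  have h2 : Complex.exp (x * Complex.I) * Complex.exp (-(x * Complex.I)) = 1 := by
    rw [← Complex.exp_add]; simp
  rw [h]
  push_cast
  rw [Complex.cos, neg_mul]
  linear_combination -h2

theorem cos_pos_of_mem {x : ℝ} (hx : x ∈ Set.Ioo (-(Real.pi / 2)) (Real.pi / 2)) :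
    0 < 2 * Real.cos x := by
  have := Real.cos_pos_of_mem_Ioo hx
  linarith

theorem log_one_add_circlePoint {x : ℝ} (hx : x ∈ Set.Ioo (-(Real.pi / 2)) (Real.pi / 2)) :
    Complex.log (1 + circlePoint x) = (Real.log (2 * Real.cos x) : ℂ) - x * Complex.I := by
  have hpi := Real.pi_pos
  rw [one_add_circlePoint, Complex.log_ofReal_mul (cos_pos_of_mem hx) (Complex.exp_ne_zero _),
    Complex.log_exp (by simp; linarith [hx.2]) (by simp; linarith [hx.1])]
  push_cast; ring

theorem norm_one_add_circlePoint {x : ℝ} (hx : x ∈ Set.Icc (-(Real.pi / 2)) (Real.pi / 2)) :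
    ‖1 + circlePoint x‖ = 2 * Real.cos x := by
  rw [one_add_circlePoint, norm_mul, Complex.norm_exp_ofReal_mul_I, mul_one, Complex.norm_real,
    Real.norm_of_nonneg (by have := Real.cos_nonneg_of_mem_Icc hx; linarith)]

theorem one_add_circlePoint_ne_zero {x : ℝ} (hx : x ∈ Set.Ioo (-(Real.pi / 2)) (Real.pi / 2)) :
    1 + circlePoint x ≠ 0 := by
  rw [← norm_pos_iff, norm_one_add_circlePoint (Set.Ioo_subset_Icc_self hx)]
  exact cos_pos_of_mem hx

theorem one_add_mul_circlePoint_re_pos {x : ℝ}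
    (hx : x ∈ Set.Ioo (-(Real.pi / 2)) (Real.pi / 2)) {u : ℝ} (hu : u ∈ Set.Icc (0 : ℝ) 1) :
    0 < (1 + u * circlePoint x).re := by
  have h := Real.cos_pos_of_mem_Ioo hx
  simp only [Complex.add_re, Complex.one_re, Complex.re_ofReal_mul, circlePoint_re,
    Real.cos_two_mul]
  nlinarith [hu.1, hu.2, mul_pos h h, mul_nonneg hu.1 (mul_pos h h).le]

theorem hasDerivAt_log_one_add_mul {x : ℝ} (hx : x ∈ Set.Ioo (-(Real.pi / 2)) (Real.pi / 2))
    {u : ℝ} (hu : u ∈ Set.Icc (0 : ℝ) 1) :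
    HasDerivAt (fun v : ℝ => Complex.log (1 + v * circlePoint x))
      (circlePoint x / (1 + u * circlePoint x)) u := by
  have h : HasDerivAt (fun v : ℝ => 1 + (v : ℂ) * circlePoint x) (circlePoint x) u := by
    simpa using ((Complex.ofRealCLM.hasDerivAt (x := u)).mul_const (circlePoint x)).const_add 1
  exact h.clog_real (Or.inl (one_add_mul_circlePoint_re_pos hx hu))

theorem continuousOn_kernel {x : ℝ} (hx : x ∈ Set.Ioo (-(Real.pi / 2)) (Real.pi / 2)) :
    ContinuousOn (fun u : ℝ => circlePoint x / (1 + u * circlePoint x)) (Set.Icc 0 1) := by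
  refine ContinuousOn.div (by fun_prop) (by fun_prop) fun u hu h => ?_
  have := one_add_mul_circlePoint_re_pos hx hu
  simp [h] at this

theorem integral_kernel {x : ℝ} (hx : x ∈ Set.Ioo (-(Real.pi / 2)) (Real.pi / 2)) :
    ∫ u in (0 : ℝ)..1, circlePoint x / (1 + u * circlePoint x) =
      (Real.log (2 * Real.cos x) : ℂ) - x * Complex.I := by
  rw [intervalIntegral.integral_eq_sub_of_hasDerivAt
    (f := fun v : ℝ => Complex.log (1 + v * circlePoint x))]
  · simp [log_one_add_circlePoint hx]
  · intro u hu
    rw [Set.uIcc_of_le zero_le_one] at hu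
    exact hasDerivAt_log_one_add_mul hx hu
  · apply ContinuousOn.intervalIntegrable
    rw [Set.uIcc_of_le zero_le_one]
    exact continuousOn_kernel hx

theorem neg_mem_Ioo_pi_div_two {x : ℝ} (hx : x ∈ Set.Ioo (-(Real.pi / 2)) (Real.pi / 2)) :
    -x ∈ Set.Ioo (-(Real.pi / 2)) (Real.pi / 2) := ⟨by linarith [hx.2], by linarith [hx.1]⟩

/-- The real parts log(2 cos x) agree at x and -x and cancel, leaving the bare factor x as an
integral of functions rational in w. -/
theorem integral_kernel_sub {x : ℝ} (hx : x ∈ Set.Ioo (-(Real.pi / 2)) (Real.pi / 2)) :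
    ∫ u in (0 : ℝ)..1, (circlePoint (-x) / (1 + u * circlePoint (-x)) -
      circlePoint x / (1 + u * circlePoint x)) = 2 * Complex.I * x := by
  have hint : ∀ y ∈ Set.Ioo (-(Real.pi / 2)) (Real.pi / 2), IntervalIntegrable
      (fun u : ℝ => circlePoint y / (1 + u * circlePoint y)) MeasureTheory.volume 0 1 := by
    intro y hy
    apply ContinuousOn.intervalIntegrable
    rw [Set.uIcc_of_le zero_le_one]
    exact continuousOn_kernel hy
  have hx' := neg_mem_Ioo_pi_div_two hx
  rw [intervalIntegral.integral_sub (hint _ hx') (hint _ hx), integral_kernel hx,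
    integral_kernel hx']
  simp; ring

/-- Both 1 - u ≤ |1 + uw| and |1 + w| ≤ |1 + uw| + (1 - u) are triangle inequalities; together they
bound the kernel uniformly in u. -/
theorem norm_one_add_le {w : ℂ} (hw : ‖w‖ = 1) {u : ℝ} (hu : u ∈ Set.Icc (0 : ℝ) 1) :
    ‖1 + w‖ ≤ 2 * ‖1 + u * w‖ := by
  have h1 : ‖(u : ℂ) * w‖ = u := by
    rw [norm_mul, hw, Complex.norm_real, Real.norm_of_nonneg hu.1, mul_one]
  have h2 : 1 - u ≤ ‖1 + u * w‖ := by
    have := norm_sub_norm_le (1 : ℂ) (-(u * w))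
    rw [sub_neg_eq_add, norm_neg, h1, norm_one] at this
    exact this
  have h3 : ‖1 + w‖ ≤ ‖1 + u * w‖ + (1 - u) := by
    have h4 : 1 + w = (1 + u * w) + ((1 - u : ℝ) : ℂ) * w := by push_cast; ring
    calc ‖1 + w‖ = ‖(1 + u * w) + ((1 - u : ℝ) : ℂ) * w‖ := by rw [← h4]
      _ ≤ _ := norm_add_le _ _
      _ = _ := by
        rw [norm_mul, hw, Complex.norm_real, Real.norm_of_nonneg (by linarith [hu.2]), mul_one]
  linarith

/-! ### Circle averages and Cauchy's formula -/

/-- Integrals of functions of `exp (-2 i x)` over a period are circle averages. -/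
theorem integral_comp_circlePoint (f : ℂ → ℂ) :
    ∫ x in (-(Real.pi / 2))..(Real.pi / 2), f (circlePoint x) =
      Real.pi * Real.circleAverage f 0 1 := by
  have h1 : ∀ x : ℝ, circlePoint x = circleMap 0 1 (-2 * x) := by
    intro x
    simp only [circlePoint, circleMap]
    push_cast
    rw [zero_add, one_mul]
    congr 1; ring
  have hper : Function.Periodic (fun θ => f (circleMap 0 1 θ)) (2 * Real.pi) := fun θ => by
    simp [periodic_circleMap 0 1 θ]
  have h2 := hper.intervalIntegral_add_eq (-Real.pi) 0
  simp_rw [h1]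
  rw [intervalIntegral.integral_comp_mul_left (fun θ => f (circleMap 0 1 θ)) (by norm_num),
    Real.circleAverage_def, intervalIntegral.integral_symm]
  rw [show -Real.pi + 2 * Real.pi = -2 * -(Real.pi / 2) by ring,
    show -Real.pi = -2 * (Real.pi / 2) by ring, zero_add] at h2
  rw [h2, Complex.real_smul, Complex.real_smul]
  have := Real.pi_ne_zero
  push_cast
  field_simp

theorem intervalIntegral_swap_of_bounded {F : ℝ → ℝ → ℂ} {a b c d M : ℝ}
    (hm : Measurable (Function.uncurry F))
    (hb : ∀ x ∈ Set.uIoc a b, ∀ y ∈ Set.uIoc c d, ‖F x y‖ ≤ M) :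
    ∫ x in a..b, ∫ y in c..d, F x y = ∫ y in c..d, ∫ x in a..b, F x y := by
  apply MeasureTheory.intervalIntegral_intervalIntegral_swap
  refine MeasureTheory.Measure.integrableOn_of_bounded (M := M) ?_ hm.aestronglyMeasurable ?_
  · rw [MeasureTheory.Measure.volume_eq_prod, MeasureTheory.Measure.prod_prod]
    exact ENNReal.mul_ne_top (by simp [Set.uIoc]) (by simp [Set.uIoc])
  · filter_upwards [MeasureTheory.ae_restrict_mem (measurableSet_uIoc.prod measurableSet_uIoc)]
      with p hp
    exact hb _ hp.1 _ hp.2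

theorem diffContOnCl_one_add_cpow {s : ℂ} (hs : 0 < s.re) :
    DiffContOnCl ℂ (fun z : ℂ => (1 + z) ^ s) (Metric.ball 0 1) := by
  have hre : ∀ z ∈ Metric.ball (0 : ℂ) 1, 1 + z ∈ Complex.slitPlane := by
    intro z hz
    rw [mem_ball_zero_iff] at hz
    left
    have := (abs_lt.mp (lt_of_le_of_lt (Complex.abs_re_le_norm z) hz)).1
    simp; linarith
  constructor
  · intro z hz
    exact (((differentiableAt_id.const_add 1).cpow_const (hre z hz))).differentiableWithinAt
  · rw [closure_ball _ one_ne_zero]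
    intro z hz
    rw [mem_closedBall_zero_iff] at hz
    refine ContinuousAt.continuousWithinAt ?_
    by_cases h0 : 1 + z = 0
    · have h1 : ContinuousAt (fun p : ℂ × ℂ => p.1 ^ p.2) (1 + z, s) := by
        rw [h0]; exact Complex.continuousAt_cpow_zero_of_re_pos hs
      exact h1.comp (f := fun z : ℂ => (1 + z, s)) (by fun_prop)
    · refine ContinuousAt.cpow (by fun_prop) continuousAt_const ?_
      -- In the closed disc Re z = -1 forces z = -1, the zero of 1 + z handled above; elsewhere 1 +
      -- z lies in the right half-plane.
      have h1 := (abs_le.mp ((Complex.abs_re_le_norm z).trans hz)).1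
      rcases eq_or_lt_of_le h1 with h | h
      · exfalso
        have h3 := Complex.sq_norm z
        rw [Complex.normSq_apply] at h3
        have h4 : z.im = 0 := by nlinarith [norm_nonneg z, sq_nonneg z.im]
        apply h0
        apply Complex.ext <;> simp [h4, ← h]
      · left; simp; linarith

theorem integral_one_add_circlePoint_cpow {s : ℂ} (hs : 0 < s.re) :
    ∫ x in (-(Real.pi / 2))..(Real.pi / 2), (1 + circlePoint x) ^ s = Real.pi := by
  rw [integral_comp_circlePoint (fun z => (1 + z) ^ s)]
  have h := DiffContOnCl.circleAverage (c := 0) (R := 1) (f := fun z : ℂ => (1 + z) ^ s)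
    (by simpa using diffContOnCl_one_add_cpow hs)
  simp [h]

/-- On the circle w̄ = 1/w, and 1/(w+u) - w/(1+uw) = (1/u)(1/(1+uw) - w/(w+u)). Against (1+w)^s the
first term is holomorphic in the disc and averages to its value 1 at the centre; the second is a
Cauchy kernel at -u and averages to (1-u)^s. -/
theorem integral_one_add_circlePoint_cpow_mul_kernel {s : ℝ} (hs : 0 < s) {u : ℝ}
    (hu : u ∈ Set.Ioo (0 : ℝ) 1) :
    ∫ x in (-(Real.pi / 2))..(Real.pi / 2), (1 + circlePoint x) ^ (s : ℂ) *
      (circlePoint (-x) / (1 + u * circlePoint (-x)) - circlePoint x / (1 + u * circlePoint x)) =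
      (Real.pi : ℂ) * (((1 - (1 - u) ^ s) / u : ℝ) : ℂ) := by
  have hinv : ∀ x, circlePoint (-x) = (circlePoint x)⁻¹ := fun x =>
    eq_inv_of_mul_eq_one_left (circlePoint_mul_neg x)
  have hf := diffContOnCl_one_add_cpow (s := (s : ℂ)) (by simpa using hs)
  have hu0 : (u : ℂ) ≠ 0 := by exact_mod_cast hu.1.ne'
  have hnu : ‖(u : ℂ)‖ = u := by rw [Complex.norm_real, Real.norm_of_nonneg hu.1.le]
  have hne : ∀ z : ℂ, ‖z‖ ≤ 1 → 1 + (u : ℂ) * z ≠ 0 := by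
    intro z hz h
    have : ‖(u : ℂ) * z‖ = 1 := by rw [eq_neg_of_add_eq_zero_right h]; simp
    rw [norm_mul, hnu] at this
    nlinarith [hu.1, hu.2, norm_nonneg z]
  have hg : DiffContOnCl ℂ (fun z : ℂ => (1 + u * z)⁻¹ * (1 + z) ^ (s : ℂ)) (Metric.ball 0 1) := by
    refine DiffContOnCl.smul (c := fun z : ℂ => (1 + u * z)⁻¹) ?_ hf
    refine DiffContOnCl.inv (Differentiable.diffContOnCl (by fun_prop)) fun z hz => hne z ?_
    rw [closure_ball _ one_ne_zero] at hz
    simpa using hz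
  have hne' : ∀ z : ℂ, ‖z‖ = 1 → z - (-(u : ℂ)) ≠ 0 := by
    intro z hz h
    rw [sub_eq_zero] at h
    rw [h, norm_neg, hnu] at hz
    linarith [hu.2]
  simp_rw [hinv]
  rw [integral_comp_circlePoint (fun z => (1 + z) ^ (s : ℂ) *
    (z⁻¹ / (1 + u * z⁻¹) - z / (1 + u * z)))]
  congr 1
  have h1 := DiffContOnCl.circleAverage (c := 0) (R := 1) (by simpa using hg)
  have h2 := DiffContOnCl.circleAverage_smul_div (c := 0) (R := 1) (w := -(u : ℂ))
    (by simpa using hf) (by simpa [hnu, abs_of_pos hu.1] using hu.2)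
  have hfc : ContinuousOn (fun z : ℂ => (1 + z) ^ (s : ℂ)) (Metric.sphere 0 1) :=
    hf.continuousOn_ball.mono Metric.sphere_subset_closedBall
  have hgc : ContinuousOn (fun z : ℂ => (1 + u * z)⁻¹ * (1 + z) ^ (s : ℂ)) (Metric.sphere 0 1) :=
    hg.continuousOn_ball.mono Metric.sphere_subset_closedBall
  have hkc : ContinuousOn (fun z : ℂ => ((z - 0) / (z - (-(u : ℂ)))) • (1 + z) ^ (s : ℂ))
      (Metric.sphere 0 1) := by
    refine ContinuousOn.smul (ContinuousOn.div (f := fun z : ℂ => z - 0)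
      (g := fun z : ℂ => z - (-(u : ℂ))) (by fun_prop) (by fun_prop) ?_) hfc
    intro z hz
    exact hne' z (by simpa using hz)
  have h3 : Set.EqOn (fun z : ℂ => (1 + z) ^ (s : ℂ) * (z⁻¹ / (1 + u * z⁻¹) - z / (1 + u * z)))
      (fun z => (u : ℂ)⁻¹ • ((1 + u * z)⁻¹ * (1 + z) ^ (s : ℂ) -
        ((z - 0) / (z - (-(u : ℂ)))) • (1 + z) ^ (s : ℂ))) (Metric.sphere 0 |1|) := by
    intro z hz
    have hz1 : ‖z‖ = 1 := by simpa using hz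
    have hz0 : z ≠ 0 := by rw [← norm_pos_iff, hz1]; exact one_pos
    have a1 := hne z hz1.le
    have a1' : 1 + z * u ≠ 0 := by rwa [mul_comm z]
    have a2 := hne' z hz1
    rw [sub_neg_eq_add] at a2
    have a3 : z⁻¹ / (1 + u * z⁻¹) = 1 / (z + u) := by
      field_simp
    simp only [a3, smul_eq_mul, sub_neg_eq_add, sub_zero]
    field_simp
    ring
  rw [Real.circleAverage_congr_sphere h3, Real.circleAverage_fun_smul,
    Real.circleAverage_fun_sub (hgc.circleIntegrable zero_le_one)
      (hkc.circleIntegrable zero_le_one), h1, h2]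
  have h4 : (1 + -(u : ℂ)) ^ (s : ℂ) = (((1 - u) ^ s : ℝ) : ℂ) := by
    rw [Complex.ofReal_cpow (by linarith [hu.2])]; push_cast; ring_nf
  rw [h4]
  simp only [smul_eq_mul, mul_zero, add_zero, inv_one, Complex.one_cpow]
  push_cast
  field_simp

/-! ### Moments of x(1+w)^s -/

/-- The generalised harmonic number `∫₀¹ (1 - (1 - u) ^ s) / u du`. -/
noncomputable def harmonicIntegral (s : ℝ) : ℝ := ∫ u in (0 : ℝ)..1, (1 - (1 - u) ^ s) / u

theorem norm_one_add_circlePoint_cpow_ofReal {x : ℝ} (hx : x ∈ Set.Ioo (-(Real.pi / 2)) (Real.pi / 2))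
    (s : ℝ) : ‖(1 + circlePoint x) ^ (s : ℂ)‖ = (2 * Real.cos x) ^ s := by
  rw [Complex.norm_cpow_of_ne_zero (one_add_circlePoint_ne_zero hx),
    norm_one_add_circlePoint (Set.Ioo_subset_Icc_self hx)]
  simp

theorem integral_mul_one_add_circlePoint_cpow {s : ℝ} (hs : 1 ≤ s) :
    2 * Complex.I * ∫ x in (-(Real.pi / 2))..(Real.pi / 2), x * (1 + circlePoint x) ^ (s : ℂ) =
      Real.pi * (harmonicIntegral s : ℂ) := by
  have hpi := Real.pi_pos
  have hle : -(Real.pi / 2) ≤ Real.pi / 2 := by linarith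
  have hcm : Measurable circlePoint := continuous_circlePoint.measurable
  have h1 : 2 * Complex.I * ∫ x in (-(Real.pi / 2))..(Real.pi / 2),
      x * (1 + circlePoint x) ^ (s : ℂ) = ∫ x in (-(Real.pi / 2))..(Real.pi / 2),
      ∫ u in (0 : ℝ)..1, (1 + circlePoint x) ^ (s : ℂ) * (circlePoint (-x) /
        (1 + u * circlePoint (-x)) - circlePoint x / (1 + u * circlePoint x)) := by
    rw [← intervalIntegral.integral_const_mul]
    refine intervalIntegral.integral_congr_Ioo_of_le hle fun x hx => ?_
    simp only [intervalIntegral.integral_const_mul]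
    rw [integral_kernel_sub hx]
    ring
  -- Each of the two kernels is at most 2/(2 cos x), so the integrand is at most 4(2 cos x)^{s-1};
  -- this stays bounded because s ≥ 1.
  rw [h1, intervalIntegral_swap_of_bounded (M := 4 * 2 ^ (s - 1))]
  · rw [harmonicIntegral, ← intervalIntegral.integral_ofReal,
      ← intervalIntegral.integral_const_mul]
    exact intervalIntegral.integral_congr_Ioo_of_le zero_le_one fun u hu =>
      integral_one_add_circlePoint_cpow_mul_kernel (by linarith) hu
  · simp only [Function.uncurry_def]
    fun_prop
  · intro x hx u hu
    rw [Set.uIoc_of_le hle] at hx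
    rw [Set.uIoc_of_le zero_le_one] at hu
    have hu' : u ∈ Set.Icc (0 : ℝ) 1 := ⟨hu.1.le, hu.2⟩
    -- The half-open interval contains x = π/2, where 1 + w = 0 and the power vanishes.
    rcases eq_or_lt_of_le hx.2 with h | h
    · have h0 : 1 + circlePoint x = 0 := by
        rw [← norm_eq_zero, norm_one_add_circlePoint ⟨hx.1.le, hx.2⟩, h]; simp
      rw [h0, Complex.zero_cpow (by exact_mod_cast (by linarith : s ≠ 0))]
      simp; positivity
    · have hx' : x ∈ Set.Ioo (-(Real.pi / 2)) (Real.pi / 2) := ⟨hx.1, h⟩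
      have hc := cos_pos_of_mem hx'
      have key : ∀ y ∈ Set.Ioo (-(Real.pi / 2)) (Real.pi / 2),
          ‖circlePoint y / (1 + u * circlePoint y)‖ ≤ 2 / (2 * Real.cos y) := by
        intro y hy
        have hcy := cos_pos_of_mem hy
        have := norm_one_add_le (norm_circlePoint y) hu'
        rw [norm_one_add_circlePoint (Set.Ioo_subset_Icc_self hy)] at this
        rw [norm_div, norm_circlePoint, div_le_div_iff₀ (by linarith) hcy]
        linarith
      have k1 := key x hx'
      have k2 := key (-x) (neg_mem_Ioo_pi_div_two hx')
      rw [Real.cos_neg] at k2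
      rw [norm_mul, norm_one_add_circlePoint_cpow_ofReal hx']
      calc _ ≤ (2 * Real.cos x) ^ s * (2 / (2 * Real.cos x) + 2 / (2 * Real.cos x)) := by
            gcongr
            exact (norm_sub_le _ _).trans (add_le_add k2 k1)
        _ = 4 * (2 * Real.cos x) ^ (s - 1) := by
            rw [Real.rpow_sub_one hc.ne']; field_simp; ring
        _ ≤ _ := by
            gcongr
            linarith [Real.cos_le_one x]

/-! ### The harmonic integral as a digamma value -/

theorem intervalIntegrable_of_norm_le {f : ℝ → ℝ} {a b M : ℝ} (hm : Measurable f)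
    (hb : ∀ x ∈ Set.uIoc a b, ‖f x‖ ≤ M) :
    IntervalIntegrable f MeasureTheory.volume a b := by
  rw [intervalIntegrable_iff]
  refine MeasureTheory.Measure.integrableOn_of_bounded (M := M) (by simp [Set.uIoc])
    hm.aestronglyMeasurable ?_
  filter_upwards [MeasureTheory.ae_restrict_mem measurableSet_uIoc] with x hx using hb x hx

theorem intervalIntegrable_harmonicIntegral {s : ℝ} (hs : 1 ≤ s) :
    IntervalIntegrable (fun u : ℝ => (1 - (1 - u) ^ s) / u) MeasureTheory.volume 0 1 := by
  refine intervalIntegrable_of_norm_le (M := s) (by fun_prop) fun u hu => ?_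
  rw [Set.uIoc_of_le zero_le_one] at hu
  -- Bernoulli's inequality gives 1 - (1-u)^s ≤ su, whence the bound s.
  have h1 := one_add_mul_self_le_rpow_one_add (s := -u) (by linarith [hu.2]) hs
  have h2 : (1 - u) ^ s ≤ 1 := Real.rpow_le_one (by linarith [hu.2]) (by linarith [hu.1])
    (by linarith)
  rw [← sub_eq_add_neg] at h1
  rw [Real.norm_of_nonneg (div_nonneg (by linarith) hu.1.le), div_le_iff₀ hu.1]
  linarith

theorem harmonicIntegral_one : harmonicIntegral 1 = 1 := by
  rw [harmonicIntegral, intervalIntegral.integral_congr_Ioo_of_le (g := fun _ => (1 : ℝ))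
    zero_le_one]
  · simp
  · intro u hu
    have := hu.1.ne'
    simp only [Real.rpow_one]
    field_simp
    ring

theorem harmonicIntegral_add_one {s : ℝ} (hs : 1 ≤ s) :
    harmonicIntegral (s + 1) = harmonicIntegral s + 1 / (s + 1) := by
  rw [← sub_eq_iff_eq_add', harmonicIntegral, harmonicIntegral,
    ← intervalIntegral.integral_sub (intervalIntegrable_harmonicIntegral (by linarith))
      (intervalIntegrable_harmonicIntegral hs),
    intervalIntegral.integral_congr_Ioo_of_le (g := fun u : ℝ => (1 - u) ^ s) zero_le_one]
  · rw [intervalIntegral.integral_comp_sub_left (fun u : ℝ => u ^ s),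
      integral_rpow (Or.inl (by linarith))]
    simp [Real.zero_rpow (by linarith : s + 1 ≠ 0)]
  · intro u hu
    have := hu.1.ne'
    simp only [Real.rpow_add_one (by linarith [hu.2] : 1 - u ≠ 0)]
    field_simp
    ring

theorem harmonicIntegral_mono {s t : ℝ} (hs : 1 ≤ s) (hst : s ≤ t) :
    harmonicIntegral s ≤ harmonicIntegral t := by
  refine intervalIntegral.integral_mono_on_of_le_Ioo zero_le_one
    (intervalIntegrable_harmonicIntegral hs)
    (intervalIntegrable_harmonicIntegral (hs.trans hst)) fun u hu => ?_
  have := Real.rpow_le_rpow_of_exponent_ge (x := 1 - u) (by linarith [hu.2]) (by linarith [hu.1])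
    hst
  have := hu.1
  gcongr

theorem hasDerivAt_log_Gamma {s : ℝ} (hs : 0 < s) :
    HasDerivAt (fun x => Real.log (Real.Gamma x)) (deriv (fun x => Real.log (Real.Gamma x)) s) s := by
  refine DifferentiableAt.hasDerivAt (DifferentiableAt.log (Real.differentiableAt_Gamma fun m => ?_)
    (Real.Gamma_pos_of_pos hs).ne')
  have := Nat.cast_nonneg (α := ℝ) m
  linarith

theorem log_Gamma_add_one {s : ℝ} (hs : 0 < s) :
    Real.log (Real.Gamma (s + 1)) = Real.log s + Real.log (Real.Gamma s) := by
  rw [Real.Gamma_add_one hs.ne', Real.log_mul hs.ne' (Real.Gamma_pos_of_pos hs).ne']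

theorem deriv_log_Gamma_add_one {s : ℝ} (hs : 0 < s) :
    deriv (fun x => Real.log (Real.Gamma x)) (s + 1) =
      deriv (fun x => Real.log (Real.Gamma x)) s + 1 / s := by
  have h1 := (hasDerivAt_log_Gamma (by linarith : 0 < s + 1)).comp_add_const s 1
  have h2 := (Real.hasDerivAt_log hs.ne').add (hasDerivAt_log_Gamma hs)
  have h3 : (fun x => Real.log (Real.Gamma (x + 1))) =ᶠ[nhds s]
      (Real.log + fun x => Real.log (Real.Gamma x)) := by
    filter_upwards [lt_mem_nhds hs] with x hx using log_Gamma_add_one hx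
  rw [h1.unique (h2.congr_of_eventuallyEq h3), one_div, add_comm]

/-- This is the log-convexity of Γ. -/
theorem deriv_log_Gamma_mono {s t : ℝ} (hs : 0 < s) (hst : s ≤ t) :
    deriv (fun x => Real.log (Real.Gamma x)) s ≤ deriv (fun x => Real.log (Real.Gamma x)) t :=
  Real.convexOn_log_Gamma.monotoneOn_deriv
    (fun x hx => (hasDerivAt_log_Gamma (by simpa using hx)).differentiableAt)
    (by simpa using hs) (by simpa using hs.trans_le hst) hst

theorem deriv_log_Gamma_natCast_add_one (n : ℕ) :
    deriv (fun x => Real.log (Real.Gamma x)) (n + 1) =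
      -Real.eulerMascheroniConstant + harmonic n := by
  have h := Real.hasDerivAt_Gamma_nat n
  have hp : Real.Gamma (n + 1) ≠ 0 := (Real.Gamma_pos_of_pos (by positivity)).ne'
  rw [(h.log hp).deriv, Real.Gamma_nat_eq_factorial, mul_div_cancel_left₀]
  exact_mod_cast n.factorial_ne_zero

theorem harmonicIntegral_natCast_succ (n : ℕ) : harmonicIntegral (n + 1) = harmonic (n + 1) := by
  induction n with
  | zero => simp [harmonicIntegral_one]
  | succ n ih =>
    rw [Nat.cast_succ, harmonicIntegral_add_one (by linarith [Nat.cast_nonneg (α := ℝ) n]), ih,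
      harmonic_succ (n + 1)]
    push_cast
    simp

/-- H(s) and ψ(s+1) obey the same recurrence, so their difference is unchanged under s ↦ s + n. Both
are monotone and differ by γ at positive integers, where their increments tend to 0; squeezing s + n
between consecutive integers gives the equality in the limit. -/
theorem harmonicIntegral_eq {s : ℝ} (hs : 1 ≤ s) : harmonicIntegral s =
    deriv (fun x => Real.log (Real.Gamma x)) (s + 1) + Real.eulerMascheroniConstant := by
  have hper : ∀ n : ℕ, harmonicIntegral (s + n) -
      deriv (fun x => Real.log (Real.Gamma x)) (s + n + 1) = harmonicIntegral s -
      deriv (fun x => Real.log (Real.Gamma x)) (s + 1) := by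
    intro n
    induction n with
    | zero => simp
    | succ n ih =>
      have hn := Nat.cast_nonneg (α := ℝ) n
      rw [← ih, Nat.cast_succ, ← add_assoc, harmonicIntegral_add_one (by linarith),
        deriv_log_Gamma_add_one (s := s + n + 1) (by linarith)]
      ring
  have hbound : ∀ n : ℕ, |harmonicIntegral s - deriv (fun x => Real.log (Real.Gamma x)) (s + 1) -
      Real.eulerMascheroniConstant| ≤ 1 / ((n : ℝ) + 1) := by
    intro n
    obtain ⟨k, hk⟩ : ∃ k, ⌊s⌋₊ = k + 1 :=
      Nat.exists_eq_succ_of_ne_zero (Nat.floor_pos.mpr hs).ne'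
    have hf1 := Nat.floor_le (by linarith : 0 ≤ s)
    have hf2 := Nat.lt_floor_add_one s
    rw [hk] at hf1 hf2
    have hk0 := Nat.cast_nonneg (α := ℝ) k
    have hn0 := Nat.cast_nonneg (α := ℝ) n
    -- With ⌊s⌋ = k + 1 this gives m + 1 ≤ s + n < m + 2. Both functions vary by 1/(m+2) over the
    -- enclosing unit interval, and 1/(m+2) ≤ 1/(n+1).
    set m : ℕ := k + n with hm
    have hmr : (m : ℝ) = k + n := by rw [hm]; push_cast; ring
    push_cast at hf1 hf2
    have a1 := harmonicIntegral_mono (s := m + 1) (t := s + n) (by linarith) (by linarith)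
    have a2 := harmonicIntegral_mono (s := s + n) (t := m + 1 + 1) (by linarith) (by linarith)
    have a3 := deriv_log_Gamma_mono (s := m + 1 + 1) (t := s + n + 1) (by linarith) (by linarith)
    have a4 := deriv_log_Gamma_mono (s := s + n + 1) (t := m + 1 + 1 + 1) (by linarith)
      (by linarith)
    rw [harmonicIntegral_add_one (s := m + 1) (by linarith)] at a2
    rw [deriv_log_Gamma_add_one (s := m + 1 + 1) (by linarith)] at a4
    have a5 := deriv_log_Gamma_natCast_add_one (m + 1)
    push_cast at a5
    rw [harmonicIntegral_natCast_succ] at a1 a2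
    rw [a5] at a3 a4
    have a6 : 1 / ((m : ℝ) + 1 + 1) ≤ 1 / ((n : ℝ) + 1) :=
      one_div_le_one_div_of_le (by linarith) (by linarith)
    rw [← hper n, abs_le]
    constructor <;> linarith
  have hlim := ge_of_tendsto' tendsto_one_div_add_atTop_nhds_zero_nat hbound
  linarith [abs_nonpos_iff.mp hlim]

theorem hasDerivAt_log_Gamma_add_one {s : ℝ} (hs : 1 ≤ s) :
    HasDerivAt (fun x => Real.log (Real.Gamma (x + 1)))
      (harmonicIntegral s - Real.eulerMascheroniConstant) s := by
  rw [harmonicIntegral_eq hs, add_sub_cancel_right]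
  exact (hasDerivAt_log_Gamma (by linarith : 0 < s + 1)).comp_add_const s 1

/-! ### Raabe's formula -/

theorem continuousOn_log_Gamma :
    ContinuousOn (fun x => Real.log (Real.Gamma x)) (Set.Ioi 0) := fun x hx =>
  (hasDerivAt_log_Gamma (s := x) hx).continuousAt.continuousWithinAt

theorem intervalIntegrable_log_Gamma {a b : ℝ} (ha : 0 < a) (hb : 0 < b) :
    IntervalIntegrable (fun x => Real.log (Real.Gamma x)) MeasureTheory.volume a b :=
  (continuousOn_log_Gamma.mono fun _ hx => (lt_min ha hb).trans_le hx.1).intervalIntegrable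

theorem intervalIntegrable_log_Gamma_zero_one :
    IntervalIntegrable (fun x => Real.log (Real.Gamma x)) MeasureTheory.volume 0 1 := by
  have h : IntervalIntegrable (fun x => Real.log (Real.Gamma (x + 1))) MeasureTheory.volume 0 1 := by
    have := (intervalIntegrable_log_Gamma (a := 1) (b := 2) one_pos two_pos).comp_add_right 1
    norm_num at this
    exact this
  refine (h.sub intervalIntegral.intervalIntegrable_log').congr fun x hx => ?_
  rw [Set.uIoc_of_le zero_le_one] at hx
  simp only [log_Gamma_add_one hx.1]
  ring

/-- Averaging with x ↦ 1 - x and applying the reflection formula reduces the integral to that of log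
sin. -/
theorem integral_log_Gamma_zero_one :
    ∫ x in (0 : ℝ)..1, Real.log (Real.Gamma x) = Real.log (2 * Real.pi) / 2 := by
  have hpi := Real.pi_pos
  have h1 : ∫ x in (0 : ℝ)..1, Real.log (Real.Gamma (1 - x)) =
      ∫ x in (0 : ℝ)..1, Real.log (Real.Gamma x) := by
    rw [intervalIntegral.integral_comp_sub_left (fun x => Real.log (Real.Gamma x))]
    simp
  have hint : IntervalIntegrable (fun x => Real.log (Real.Gamma (1 - x)))
      MeasureTheory.volume 0 1 := by
    have := (intervalIntegrable_log_Gamma_zero_one.comp_sub_left 1).symm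
    simpa using this
  have h2 := intervalIntegral.integral_add intervalIntegrable_log_Gamma_zero_one hint
  have hsin : IntervalIntegrable (fun x => Real.log (Real.sin (Real.pi * x)))
      MeasureTheory.volume 0 1 := by
    have := (intervalIntegrable_log_sin (a := 0) (b := Real.pi)).comp_mul_left (c := Real.pi)
    simpa [hpi.ne'] using this
  have h3 : ∫ x in (0 : ℝ)..1, (Real.log (Real.Gamma x) + Real.log (Real.Gamma (1 - x))) =
      ∫ x in (0 : ℝ)..1, (Real.log Real.pi - Real.log (Real.sin (Real.pi * x))) := by
    refine intervalIntegral.integral_congr_Ioo_of_le zero_le_one fun x hx => ?_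
    have hs : 0 < Real.sin (Real.pi * x) :=
      Real.sin_pos_of_pos_of_lt_pi (by nlinarith [hx.1]) (by nlinarith [hx.2])
    rw [← Real.log_mul (Real.Gamma_pos_of_pos hx.1).ne'
      (Real.Gamma_pos_of_pos (by linarith [hx.2])).ne', Real.Gamma_mul_Gamma_one_sub,
      Real.log_div hpi.ne' hs.ne']
  have h4 : ∫ x in (0 : ℝ)..1, Real.log (Real.sin (Real.pi * x)) = -Real.log 2 := by
    rw [intervalIntegral.integral_comp_mul_left (fun x => Real.log (Real.sin x)) hpi.ne']
    simp only [mul_zero, mul_one, integral_log_sin_zero_pi, smul_eq_mul]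
    field_simp
  rw [h3, h1, intervalIntegral.integral_sub (by simp) hsin, h4] at h2
  rw [Real.log_mul two_ne_zero hpi.ne']
  norm_num at h2
  linarith

/-- Raabe's formula. -/
theorem integral_log_Gamma {a : ℝ} (ha : 0 < a) :
    ∫ x in a..(a + 1), Real.log (Real.Gamma x) =
      a * Real.log a - a + Real.log (2 * Real.pi) / 2 := by
  have hz : ∀ b : ℝ, 0 < b → IntervalIntegrable (fun x => Real.log (Real.Gamma x))
      MeasureTheory.volume 0 b := fun b hb =>
    intervalIntegrable_log_Gamma_zero_one.trans (intervalIntegrable_log_Gamma one_pos hb)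
  -- The recurrence Γ(x+1) = xΓ(x) makes the integrals over [1, a+1] and [0, a] differ by the
  -- integral of log x; removing the common overlap compares [a, a+1] with [0, 1].
  have h1 : ∫ x in (1 : ℝ)..(a + 1), Real.log (Real.Gamma x) =
      ∫ x in (0 : ℝ)..a, (Real.log x + Real.log (Real.Gamma x)) := by
    have := intervalIntegral.integral_comp_add_right (a := 0) (b := a)
      (fun x => Real.log (Real.Gamma x)) 1
    rw [zero_add] at this
    rw [← this]
    exact intervalIntegral.integral_congr_Ioo_of_le ha.le fun x hx => log_Gamma_add_one hx.1
  rw [intervalIntegral.integral_add intervalIntegral.intervalIntegrable_log' (hz a ha),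
    integral_log] at h1
  have h2 := intervalIntegral.integral_interval_sub_left (hz (a + 1) (by linarith)) (hz a ha)
  have h3 := intervalIntegral.integral_interval_sub_left (hz (a + 1) (by linarith)) (hz 1 one_pos)
  rw [integral_log_Gamma_zero_one] at h3
  simp at h1
  linarith

/-! ### The logarithmic integrand for real exponents at least 1 -/

theorem continuous_one_add_circlePoint_cpow {s : ℂ} (hs : 0 < s.re) :
    Continuous fun x => (1 + circlePoint x) ^ s :=
  (diffContOnCl_one_add_cpow hs).continuousOn_ball.comp_continuous continuous_circlePoint
    fun x => by simp [norm_circlePoint]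

theorem one_add_circlePoint_pi_div_two : 1 + circlePoint (Real.pi / 2) = 0 := by
  have := Real.pi_pos
  rw [← norm_eq_zero, norm_one_add_circlePoint ⟨by linarith, le_rfl⟩]; simp

theorem one_add_circlePoint_neg_pi_div_two : 1 + circlePoint (-(Real.pi / 2)) = 0 := by
  have := Real.pi_pos
  rw [← norm_eq_zero, norm_one_add_circlePoint ⟨le_rfl, by linarith⟩]; simp

theorem one_add_circlePoint_mem_slitPlane {x : ℝ}
    (hx : x ∈ Set.Ioo (-(Real.pi / 2)) (Real.pi / 2)) : 1 + circlePoint x ∈ Complex.slitPlane := by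
  left
  simpa using one_add_mul_circlePoint_re_pos hx (u := 1) (by simp)

theorem integral_mul_circlePoint_neg_mul_cpow {s : ℝ} (hs : 1 ≤ s) :
    2 * Complex.I * ∫ x in (-(Real.pi / 2))..(Real.pi / 2),
      x * circlePoint (-x) * (1 + circlePoint x) ^ (s : ℂ) =
      Real.pi * ((s * harmonicIntegral s - s - 1 : ℝ) : ℂ) := by
  have hpi := Real.pi_pos
  have hre : 0 < (s : ℂ).re := by simp; linarith
  have hre1 : 0 < ((s : ℂ) + 1).re := by simp; linarith
  have hs1 : (s : ℂ) + 1 ≠ 0 := fun h => by simp [h] at hre1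
  have hc := continuous_one_add_circlePoint_cpow hre
  have hc1 := continuous_one_add_circlePoint_cpow hre1
  have hcp := continuous_circlePoint
  have i1 : IntervalIntegrable (fun x : ℝ => 2 * Complex.I *
      (x * circlePoint (-x) * (1 + circlePoint x) ^ (s : ℂ))) MeasureTheory.volume
      (-(Real.pi / 2)) (Real.pi / 2) := Continuous.intervalIntegrable (by fun_prop) _ _
  have i2 : IntervalIntegrable (fun x : ℝ => s * (2 * Complex.I *
      (x * (1 + circlePoint x) ^ (s : ℂ)))) MeasureTheory.volume
      (-(Real.pi / 2)) (Real.pi / 2) := Continuous.intervalIntegrable (by fun_prop) _ _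
  have i3 : IntervalIntegrable (fun x : ℝ => ((s : ℂ) + 1) *
      (1 + circlePoint x) ^ (s : ℂ)) MeasureTheory.volume
      (-(Real.pi / 2)) (Real.pi / 2) := Continuous.intervalIntegrable (by fun_prop) _ _
  have hftc := intervalIntegral.integral_eq_sub_of_hasDerivAt_of_le
    (a := -(Real.pi / 2)) (b := Real.pi / 2) (by linarith)
    -- Differentiating x w̄(1+w)^{s+1} leaves a stray term w̄(1+w)^{s+1}; the summand i/2 trades it
    -- for (s+1)(1+w)^s, whose integral is known. The primitive vanishes at both endpoints, since 1
    -- + w = 0 there.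
    (f := fun x : ℝ => (x + Complex.I / 2) * circlePoint (-x) *
      (1 + circlePoint x) ^ ((s : ℂ) + 1))
    (f' := fun x : ℝ => 2 * Complex.I * (x * circlePoint (-x) * (1 + circlePoint x) ^ (s : ℂ)) -
      s * (2 * Complex.I * (x * (1 + circlePoint x) ^ (s : ℂ))) +
      ((s : ℂ) + 1) * (1 + circlePoint x) ^ (s : ℂ))
    (Continuous.continuousOn (by fun_prop)) ?_ ((i1.sub i2).add i3)
  · rw [intervalIntegral.integral_add (i1.sub i2) i3, intervalIntegral.integral_sub i1 i2,
      intervalIntegral.integral_const_mul, intervalIntegral.integral_const_mul,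
      intervalIntegral.integral_const_mul, intervalIntegral.integral_const_mul,
      integral_mul_one_add_circlePoint_cpow hs, integral_one_add_circlePoint_cpow hre,
      one_add_circlePoint_pi_div_two, one_add_circlePoint_neg_pi_div_two,
      Complex.zero_cpow hs1] at hftc
    push_cast
    linear_combination hftc
  · intro x hx
    have d1 : HasDerivAt (fun y : ℝ => (y : ℂ) + Complex.I / 2) 1 x :=
      (Complex.ofRealCLM.hasDerivAt (x := x)).add_const _
    have d2 : HasDerivAt (fun y : ℝ => circlePoint (-y)) (2 * Complex.I * circlePoint (-x)) x := by
      have := (hasDerivAt_circlePoint (-x)).scomp x (hasDerivAt_neg x)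
      exact this.congr_deriv (by simp)
    have d4 : HasDerivAt (fun y : ℝ => (1 + circlePoint y) ^ ((s : ℂ) + 1))
        (((s : ℂ) + 1) * (1 + circlePoint x) ^ (s : ℂ) * (-2 * Complex.I * circlePoint x)) x := by
      have := (hasDerivAt_id (1 + circlePoint x)).cpow_const (c := (s : ℂ) + 1)
        (one_add_circlePoint_mem_slitPlane hx)
      have h := HasDerivAt.comp_of_eq (h₂ := fun z : ℂ => z ^ ((s : ℂ) + 1)) x this
        ((hasDerivAt_circlePoint x).const_add 1) rfl
      exact h.congr_deriv (by simp)
    refine ((d1.mul d2).mul d4).congr_deriv ?_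
    have e1 : (1 + circlePoint x) ^ ((s : ℂ) + 1) =
        (1 + circlePoint x) ^ (s : ℂ) * (1 + circlePoint x) := by
      rw [Complex.cpow_add _ _ (one_add_circlePoint_ne_zero hx), Complex.cpow_one]
    have e2 := circlePoint_mul_neg x
    simp only [e1, Pi.mul_apply]
    have e3 := Complex.I_sq
    generalize (1 + circlePoint x) ^ (s : ℂ) = P
    generalize circlePoint (-x) = v at *
    generalize circlePoint x = w at *
    linear_combination (v * P * (1 + w) - (s + 1) * P * (v * w)) * e3 +
      (2 * Complex.I * x * P - 2 * Complex.I * x * (s + 1) * P + (s + 1) * P) * e2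

theorem log_one_add_circlePoint_ne_zero {x : ℝ}
    (hx : x ∈ Set.Ioo (-(Real.pi / 2)) (Real.pi / 2)) : Complex.log (1 + circlePoint x) ≠ 0 := by
  intro h
  have h1 := Complex.exp_log (one_add_circlePoint_ne_zero hx)
  rw [h, Complex.exp_zero] at h1
  have h2 := norm_circlePoint x
  rw [left_eq_add.mp h1] at h2
  simp at h2

theorem integral_one_add_circlePoint_cpow_exponent (b : ℝ) {x : ℝ}
    (hx : x ∈ Set.Ioo (-(Real.pi / 2)) (Real.pi / 2)) :
    ∫ s in b..(b + 1), circlePoint (-x) * (1 + circlePoint x) ^ (s : ℂ) =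
      (1 + circlePoint x) ^ (b : ℂ) / Complex.log (1 + circlePoint x) := by
  have hl := log_one_add_circlePoint_ne_zero hx
  have h0 := one_add_circlePoint_ne_zero hx
  have hd : ∀ s : ℝ, HasDerivAt (fun t : ℝ => circlePoint (-x) * ((1 + circlePoint x) ^ (t : ℂ) /
      Complex.log (1 + circlePoint x))) (circlePoint (-x) * (1 + circlePoint x) ^ (s : ℂ)) s := by
    intro s
    have h1 := ((hasDerivAt_id (s : ℂ)).const_cpow (c := 1 + circlePoint x) (Or.inl h0)).comp_ofReal
    refine ((h1.div_const (Complex.log (1 + circlePoint x))).const_mul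
      (circlePoint (-x))).congr_deriv ?_
    simp only [id]
    field_simp
  rw [intervalIntegral.integral_eq_sub_of_hasDerivAt (fun s _ => hd s)]
  · push_cast
    rw [Complex.cpow_add _ _ h0, Complex.cpow_one]
    have e2 := circlePoint_mul_neg x
    field_simp
    linear_combination (1 + circlePoint x) ^ (b : ℂ) * e2
  · refine Continuous.intervalIntegrable ?_ _ _
    refine continuous_const.mul (continuous_iff_continuousAt.mpr fun s => ?_)
    exact ContinuousAt.const_cpow (by fun_prop) (Or.inl h0)

theorem integral_mul_cpow_div_log_eq_integral {b : ℝ} (hb : 1 ≤ b) :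
    2 * Complex.I * ∫ x in (-(Real.pi / 2))..(Real.pi / 2),
      x * (1 + circlePoint x) ^ (b : ℂ) / Complex.log (1 + circlePoint x) =
      Real.pi * ((∫ s in b..(b + 1), (s * harmonicIntegral s - s - 1) : ℝ) : ℂ) := by
  have hpi := Real.pi_pos
  have hle : -(Real.pi / 2) ≤ Real.pi / 2 := by linarith
  have hcm : Measurable circlePoint := continuous_circlePoint.measurable
  have h1 : ∫ x in (-(Real.pi / 2))..(Real.pi / 2),
      x * (1 + circlePoint x) ^ (b : ℂ) / Complex.log (1 + circlePoint x) =
      ∫ x in (-(Real.pi / 2))..(Real.pi / 2), ∫ s in b..(b + 1),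
        x * circlePoint (-x) * (1 + circlePoint x) ^ (s : ℂ) := by
    refine intervalIntegral.integral_congr_Ioo_of_le hle fun x hx => ?_
    simp only [mul_assoc, intervalIntegral.integral_const_mul]
    rw [← intervalIntegral.integral_const_mul, integral_one_add_circlePoint_cpow_exponent b hx,
      mul_div_assoc]
  rw [h1, intervalIntegral_swap_of_bounded (M := Real.pi / 2 * 2 ^ (b + 1)),
    ← intervalIntegral.integral_const_mul, ← intervalIntegral.integral_ofReal,
    ← intervalIntegral.integral_const_mul]
  · refine intervalIntegral.integral_congr_Ioo_of_le (by linarith) fun s hs => ?_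
    exact integral_mul_circlePoint_neg_mul_cpow (by linarith [hs.1])
  · simp only [Function.uncurry_def]
    fun_prop
  · intro x hx s hs
    rw [Set.uIoc_of_le hle] at hx
    rw [Set.uIoc_of_le (by linarith)] at hs
    have h2 : ‖1 + circlePoint x‖ ≤ 2 := by
      have := norm_add_le 1 (circlePoint x)
      rw [norm_circlePoint, norm_one] at this
      linarith
    rw [norm_mul, norm_mul, norm_circlePoint, mul_one, Complex.norm_real, Complex.norm_cpow_real]
    have h3 : ‖1 + circlePoint x‖ ^ s ≤ 2 ^ (b + 1) :=
      (Real.rpow_le_rpow (norm_nonneg _) h2 (by linarith [hs.1])).trans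
        (Real.rpow_le_rpow_of_exponent_le one_le_two hs.2)
    have h4 : ‖x‖ ≤ Real.pi / 2 := abs_le.mpr ⟨hx.1.le, hx.2⟩
    gcongr

theorem integral_mul_harmonicIntegral {b : ℝ} (hb : 1 ≤ b) :
    ∫ s in b..(b + 1), (s * harmonicIntegral s - s - 1) = Real.log (Real.Gamma (b + 1)) +
      Real.eulerMascheroniConstant * (b + 1 / 2) - 1 / 2 - Real.log (2 * Real.pi) / 2 := by
  have hmono : IntervalIntegrable harmonicIntegral MeasureTheory.volume b (b + 1) := by
    apply MonotoneOn.intervalIntegrable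
    rw [Set.uIcc_of_le (by linarith)]
    intro s hs t _ hst
    exact harmonicIntegral_mono (hb.trans hs.1) hst
  have i1 : IntervalIntegrable (fun s => s * harmonicIntegral s - s - 1) MeasureTheory.volume
      b (b + 1) :=
    ((hmono.continuousOn_mul continuousOn_id).sub
      (Continuous.intervalIntegrable continuous_id _ _)).sub (by simp)
  have i2 : IntervalIntegrable (fun s => Real.log (Real.Gamma (s + 1))) MeasureTheory.volume
      b (b + 1) := by
    have := (intervalIntegrable_log_Gamma (a := b + 1) (b := b + 1 + 1) (by linarith)
      (by linarith)).comp_add_right 1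
    simpa using this
  have hftc := intervalIntegral.integral_eq_sub_of_hasDerivAt (a := b) (b := b + 1)
    -- Since (log Γ(s+1))' = H(s) - γ, the quadratic term corrects -γs to -s. The extra log Γ(s+1)
    -- in the derivative is integrated by Raabe's formula.
    (f := fun s => s * Real.log (Real.Gamma (s + 1)) +
      (Real.eulerMascheroniConstant - 1) / 2 * s ^ 2 - s)
    (f' := fun s => (s * harmonicIntegral s - s - 1) + Real.log (Real.Gamma (s + 1))) ?_ (i1.add i2)
  · rw [intervalIntegral.integral_add i1 i2,
      intervalIntegral.integral_comp_add_right (fun x => Real.log (Real.Gamma x)),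
      integral_log_Gamma (by linarith), log_Gamma_add_one (s := b + 1) (by linarith)] at hftc
    linarith
  · intro s hs
    rw [Set.uIcc_of_le (by linarith)] at hs
    have h1 := hasDerivAt_log_Gamma_add_one (hb.trans hs.1)
    refine ((((hasDerivAt_id s).mul h1).add (((hasDerivAt_id s).pow 2).const_mul
      ((Real.eulerMascheroniConstant - 1) / 2))).sub (hasDerivAt_id s)).congr_deriv ?_
    simp
    ring

theorem integral_mul_cpow_div_log_ofReal {b : ℝ} (hb : 1 ≤ b) :
    1 / (2 * Complex.I) * ∫ x in (-(Real.pi / 2))..(Real.pi / 2),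
      x * (1 + circlePoint x) ^ (b : ℂ) / Complex.log (1 + circlePoint x) =
      (Real.pi : ℂ) / 8 * (1 + (Real.log (2 * Real.pi) : ℂ) -
        (Real.eulerMascheroniConstant : ℂ) * (2 * b + 1) - 2 * logGamma (b + 1)) := by
  have h := integral_mul_cpow_div_log_eq_integral hb
  rw [integral_mul_harmonicIntegral hb] at h
  have h2 := logGamma_ofReal (x := b + 1) (by linarith)
  push_cast at h h2
  rw [h2]
  have h3 : (1 : ℂ) / (2 * Complex.I) = -(1 / 4) * (2 * Complex.I) := by
    field_simp
    rw [Complex.I_sq]; ring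
  rw [h3, mul_assoc, h]
  ring

/-! ### Convergence and analytic continuation in the exponent -/

theorem intervalIntegrable_two_mul_cos_rpow {c : ℝ} (hc : -1 < c) (hc0 : c ≤ 0) :
    IntervalIntegrable (fun x => (2 * Real.cos x) ^ c) MeasureTheory.volume
      (-(Real.pi / 2)) (Real.pi / 2) := by
  have hpi := Real.pi_pos
  have hpi4 := Real.pi_le_four
  have h0 : IntervalIntegrable (fun x => (2 * Real.cos x) ^ c) MeasureTheory.volume
      0 (Real.pi / 2) := by
    have h1 : IntervalIntegrable (fun x => (Real.pi / 2 - x) ^ c) MeasureTheory.volume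
        0 (Real.pi / 2) := by
      have := ((intervalIntegral.intervalIntegrable_rpow' hc
        (a := 0) (b := Real.pi / 2)).comp_sub_left (Real.pi / 2)).symm
      simpa using this
    refine h1.mono_fun (Measurable.aestronglyMeasurable (by fun_prop)) ?_
    have hne : ∀ᵐ x : ℝ ∂(MeasureTheory.volume.restrict (Set.uIoc 0 (Real.pi / 2))),
        x ≠ Real.pi / 2 :=
      MeasureTheory.ae_restrict_of_ae (MeasureTheory.Measure.ae_ne _ _)
    filter_upwards [MeasureTheory.ae_restrict_mem measurableSet_uIoc, hne] with x hx hx'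
    rw [Set.uIoc_of_le (by linarith)] at hx
    have hlt : 0 < Real.pi / 2 - x := sub_pos.mpr (lt_of_le_of_ne hx.2 hx')
    -- By concavity cos x ≥ 1 - 2x/π, so 2 cos x ≥ (4/π)(π/2 - x), and π ≤ 4. As c ≤ 0, powers
    -- reverse the inequality.
    have hcos : Real.pi / 2 - x ≤ 2 * Real.cos x := by
      have h2 := Real.one_sub_mul_le_cos hx.1.le hx.2
      have h3 : (Real.pi / 2 - x) ≤ 2 * (1 - 2 / Real.pi * x) := by
        have : 2 * (1 - 2 / Real.pi * x) = 4 / Real.pi * (Real.pi / 2 - x) := by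
          field_simp; ring
        rw [this]
        exact le_mul_of_one_le_left hlt.le ((one_le_div hpi).mpr hpi4)
      linarith
    rw [Real.norm_of_nonneg (Real.rpow_nonneg (hlt.le.trans hcos) _),
      Real.norm_of_nonneg (Real.rpow_nonneg hlt.le _)]
    exact Real.rpow_le_rpow_of_nonpos hlt hcos hc0
  refine IntervalIntegrable.trans (b := 0) ?_ h0
  have := (IntervalIntegrable.iff_comp_neg (by finiteness)).mp h0
  simpa using this.symm

/-- A majorant uniform for exponents in a rectangle: 2 cos x ≤ 2 absorbs the excess real part, and
|arg| ≤ π controls the imaginary part. -/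
theorem norm_one_add_circlePoint_cpow_le {b : ℂ} {c C B : ℝ} (hc : c ≤ b.re) (hC : b.re ≤ C)
    (hB : |b.im| ≤ B) {x : ℝ} (hx : x ∈ Set.Ioo (-(Real.pi / 2)) (Real.pi / 2)) :
    ‖(1 + circlePoint x) ^ b‖ ≤ 2 ^ (C - c) * Real.exp (Real.pi * B) * (2 * Real.cos x) ^ c := by
  have hp := cos_pos_of_mem hx
  have h1 : (2 * Real.cos x) ^ b.re ≤ 2 ^ (C - c) * (2 * Real.cos x) ^ c := by
    rw [← sub_add_cancel b.re c, Real.rpow_add hp]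
    refine mul_le_mul_of_nonneg_right ?_ (Real.rpow_nonneg hp.le _)
    exact (Real.rpow_le_rpow hp.le (by linarith [Real.cos_le_one x]) (by linarith)).trans
      (Real.rpow_le_rpow_of_exponent_le one_le_two (by linarith))
  have h2 : -(Complex.arg (1 + circlePoint x) * b.im) ≤ Real.pi * B := by
    refine (neg_le_abs _).trans ?_
    rw [abs_mul]
    exact mul_le_mul (Complex.abs_arg_le_pi _) hB (abs_nonneg _) Real.pi_pos.le
  rw [Complex.norm_cpow_of_ne_zero (one_add_circlePoint_ne_zero hx),
    norm_one_add_circlePoint (Set.Ioo_subset_Icc_self hx), div_eq_mul_inv, ← Real.exp_neg]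
  calc _ ≤ 2 ^ (C - c) * (2 * Real.cos x) ^ c * Real.exp (Real.pi * B) := by gcongr
    _ = _ := by ring

/-- The imaginary part of the logarithm is -x, so the zero of log(2 cos x) at |x| = π/3 does no
harm. -/
theorem norm_div_log_one_add_circlePoint_le {x : ℝ}
    (hx : x ∈ Set.Ioo (-(Real.pi / 2)) (Real.pi / 2)) :
    ‖(x : ℂ) / Complex.log (1 + circlePoint x)‖ ≤ 1 := by
  rw [norm_div, Complex.norm_real]
  refine div_le_one_of_le₀ ?_ (norm_nonneg _)
  have h := Complex.abs_im_le_norm (Complex.log (1 + circlePoint x))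
  rw [log_one_add_circlePoint hx] at h ⊢
  simpa using h

theorem ae_mem_Ioo_of_mem_uIoc {a b : ℝ} (hab : a ≤ b) :
    ∀ᵐ x : ℝ, x ∈ Set.uIoc a b → x ∈ Set.Ioo a b := by
  filter_upwards [MeasureTheory.Measure.ae_ne MeasureTheory.volume b] with x hx hx'
  rw [Set.uIoc_of_le hab] at hx'
  exact ⟨hx'.1, lt_of_le_of_ne hx'.2 hx⟩

theorem neg_pi_div_two_le_pi_div_two : -(Real.pi / 2) ≤ Real.pi / 2 := by
  linarith [Real.pi_pos]

theorem measurable_mul_cpow_div_log (b : ℂ) : Measurable fun x : ℝ =>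
    (x : ℂ) * (1 + circlePoint x) ^ b / Complex.log (1 + circlePoint x) := by
  have hcm : Measurable circlePoint := continuous_circlePoint.measurable
  fun_prop

theorem intervalIntegrable_mul_cpow_div_log {b : ℂ} (hb : -1 < b.re) :
    IntervalIntegrable (fun x : ℝ => (x : ℂ) * (1 + circlePoint x) ^ b /
      Complex.log (1 + circlePoint x)) MeasureTheory.volume (-(Real.pi / 2)) (Real.pi / 2) := by
  have hc : -1 < min b.re 0 := lt_min hb (by norm_num)
  refine ((intervalIntegrable_two_mul_cos_rpow hc (min_le_right _ _)).const_mul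
    (2 ^ (b.re - min b.re 0) * Real.exp (Real.pi * |b.im|))).mono_fun'
    (measurable_mul_cpow_div_log b).aestronglyMeasurable ?_
  rw [Filter.EventuallyLE, MeasureTheory.ae_restrict_iff' measurableSet_uIoc]
  filter_upwards [ae_mem_Ioo_of_mem_uIoc neg_pi_div_two_le_pi_div_two] with x hx hx'
  have h1 := norm_one_add_circlePoint_cpow_le (min_le_left b.re 0) le_rfl le_rfl (hx hx')
  have h2 := norm_div_log_one_add_circlePoint_le (hx hx')
  rw [mul_div_right_comm, norm_mul]
  exact (mul_le_of_le_one_left (norm_nonneg _) h2).trans h1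

theorem differentiableAt_integral_mul_cpow_div_log {b : ℂ} (hb : -1 < b.re) :
    DifferentiableAt ℂ (fun b : ℂ => ∫ x in (-(Real.pi / 2))..(Real.pi / 2),
      (x : ℂ) * (1 + circlePoint x) ^ b / Complex.log (1 + circlePoint x)) b := by
  obtain ⟨c, hc1, hc2⟩ := exists_between (lt_min hb (by norm_num : (-1 : ℝ) < 0))
  have hcb := hc2.trans_le (min_le_left _ _)
  have hc0 := hc2.le.trans (min_le_right _ _)
  have hcm : Measurable circlePoint := continuous_circlePoint.measurable
  set ε := min (b.re - c) 1 with hε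
  have hε0 : 0 < ε := lt_min (by linarith) one_pos
  have hball : ∀ z ∈ Metric.ball b ε, c ≤ z.re ∧ z.re ≤ b.re + 1 ∧ |z.im| ≤ |b.im| + 1 := by
    intro z hz
    rw [mem_ball_iff_norm] at hz
    have h1 := abs_le.mp ((Complex.abs_re_le_norm (z - b)).trans hz.le)
    have h2 := (Complex.abs_im_le_norm (z - b)).trans hz.le
    have h3 : ε ≤ b.re - c := min_le_left _ _
    have h4 : ε ≤ 1 := min_le_right _ _
    simp only [Complex.sub_re, Complex.sub_im] at h1 h2
    refine ⟨by linarith, by linarith, ?_⟩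
    linarith [abs_sub_abs_le_abs_sub z.im b.im]
  refine (intervalIntegral.hasDerivAt_integral_of_dominated_loc_of_deriv_le
    -- Differentiating in the exponent produces a factor log(1+w), which cancels the denominator.
    (F' := fun (b : ℂ) (x : ℝ) => (x : ℂ) * (1 + circlePoint x) ^ b)
    (bound := fun x => Real.pi / 2 * (2 ^ (b.re + 1 - c) * Real.exp (Real.pi * (|b.im| + 1)) *
      (2 * Real.cos x) ^ c)) (Metric.ball_mem_nhds b hε0)
    (Filter.Eventually.of_forall fun z => (measurable_mul_cpow_div_log z).aestronglyMeasurable)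
    (intervalIntegrable_mul_cpow_div_log hb)
    (Measurable.aestronglyMeasurable (by fun_prop)) ?_
    (((intervalIntegrable_two_mul_cos_rpow hc1 hc0).const_mul _).const_mul _)
    ?_).2.differentiableAt
  · filter_upwards [ae_mem_Ioo_of_mem_uIoc neg_pi_div_two_le_pi_div_two] with x hx hx' z hz
    obtain ⟨h1, h2, h3⟩ := hball z hz
    have hx1 : ‖(x : ℂ)‖ ≤ Real.pi / 2 := by
      rw [Complex.norm_real]
      exact abs_le.mpr ⟨(hx hx').1.le, (hx hx').2.le⟩
    rw [norm_mul]
    exact mul_le_mul hx1 (norm_one_add_circlePoint_cpow_le h1 h2 h3 (hx hx')) (norm_nonneg _)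
      (by linarith [Real.pi_pos])
  · filter_upwards [ae_mem_Ioo_of_mem_uIoc neg_pi_div_two_le_pi_div_two] with x hx hx' z _
    have hl := log_one_add_circlePoint_ne_zero (hx hx')
    refine ((((hasDerivAt_id z).const_cpow (Or.inl (one_add_circlePoint_ne_zero (hx hx')))).const_mul
      (x : ℂ)).div_const (Complex.log (1 + circlePoint x))).congr_deriv ?_
    simp only [id]
    field_simp

theorem integral_mul_cpow_div_log {b : ℂ} (hb : -1 < b.re) :
    1 / (2 * Complex.I) * ∫ x in (-(Real.pi / 2))..(Real.pi / 2),
      (x : ℂ) * (1 + circlePoint x) ^ b / Complex.log (1 + circlePoint x) =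
      (Real.pi : ℂ) / 8 * (1 + (Real.log (2 * Real.pi) : ℂ) -
        (Real.eulerMascheroniConstant : ℂ) * (2 * b + 1) - 2 * logGamma (b + 1)) := by
  have hopen : IsOpen {z : ℂ | -1 < z.re} := isOpen_lt continuous_const Complex.continuous_re
  have hpre : IsPreconnected {z : ℂ | -1 < z.re} := (convex_halfSpace_re_gt (-1)).isPreconnected
  have hL : DifferentiableOn ℂ (fun b : ℂ => 1 / (2 * Complex.I) *
      ∫ x in (-(Real.pi / 2))..(Real.pi / 2),
        (x : ℂ) * (1 + circlePoint x) ^ b / Complex.log (1 + circlePoint x))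
      {z : ℂ | -1 < z.re} := fun z hz =>
    ((differentiableAt_integral_mul_cpow_div_log hz).const_mul _).differentiableWithinAt
  have hG : DifferentiableOn ℂ (fun b : ℂ => logGamma (b + 1)) {z : ℂ | -1 < z.re} :=
    logGamma_differentiableOn.comp (by fun_prop) fun z hz => by
      have hz' : -1 < z.re := hz
      simp only [Set.mem_ofPred_eq, Complex.add_re, Complex.one_re]
      linarith
  have hR : DifferentiableOn ℂ (fun b : ℂ => (Real.pi : ℂ) / 8 *
      (1 + (Real.log (2 * Real.pi) : ℂ) - (Real.eulerMascheroniConstant : ℂ) * (2 * b + 1) -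
        2 * logGamma (b + 1))) {z : ℂ | -1 < z.re} := by fun_prop
  refine (hL.analyticOnNhd hopen).eqOn_of_preconnected_of_frequently_eq (hR.analyticOnNhd hopen)
    hpre (z₀ := 1) (by simp) ?_ hb
  -- The points 1 + 1/(n+1) lie in the real range b ≥ 1 already settled and accumulate at 1, as the
  -- identity theorem requires.
  have hlim : Filter.Tendsto (fun n : ℕ => ((1 + 1 / ((n : ℝ) + 1) : ℝ) : ℂ)) Filter.atTop
      (nhdsWithin 1 {1}ᶜ) := by
    refine tendsto_nhdsWithin_iff.mpr ⟨?_, Filter.Eventually.of_forall fun n => ?_⟩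
    · have := (tendsto_one_div_add_atTop_nhds_zero_nat (𝕜 := ℝ)).const_add 1
      rw [add_zero] at this
      have h := (Complex.continuous_ofReal.tendsto 1).comp this
      rw [Complex.ofReal_one] at h
      exact h
    · have : (0 : ℝ) < 1 / ((n : ℝ) + 1) := by positivity
      intro h
      have h' : (1 + 1 / ((n : ℝ) + 1) : ℝ) = 1 :=
        Complex.ofReal_injective (h.trans Complex.ofReal_one.symm)
      linarith
  refine hlim.frequently (Filter.Frequently.of_forall fun n => ?_)
  have : (0 : ℝ) < 1 / ((n : ℝ) + 1) := by positivity
  exact integral_mul_cpow_div_log_ofReal (by linarith)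

/-! ### The case β = 0 and the conclusion -/

theorem intervalIntegrable_sq_div_sq_add_log_sq :
    IntervalIntegrable (fun x : ℝ => x ^ 2 / (x ^ 2 + Real.log (2 * Real.cos x) ^ 2))
      MeasureTheory.volume 0 (Real.pi / 2) := by
  refine intervalIntegrable_of_norm_le (M := 1) (by fun_prop) fun x _ => ?_
  rw [Real.norm_of_nonneg (by positivity)]
  exact div_le_one_of_le₀ (le_add_of_nonneg_right (sq_nonneg _)) (by positivity)

/-- The two denominators are complex conjugates L ∓ ix with L = log(2 cos x), so the even part of
the integrand has denominator x² + L². -/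
theorem div_log_one_add_circlePoint_add_neg {x : ℝ}
    (hx : x ∈ Set.Ioo (-(Real.pi / 2)) (Real.pi / 2)) :
    (x : ℂ) / Complex.log (1 + circlePoint x) +
      ((-x : ℝ) : ℂ) / Complex.log (1 + circlePoint (-x)) =
      2 * Complex.I * ((x ^ 2 / (x ^ 2 + Real.log (2 * Real.cos x) ^ 2) : ℝ) : ℂ) := by
  have h1 := log_one_add_circlePoint_ne_zero hx
  have h2 := log_one_add_circlePoint_ne_zero (neg_mem_Ioo_pi_div_two hx)
  rw [log_one_add_circlePoint hx] at h1 ⊢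
  rw [log_one_add_circlePoint (neg_mem_Ioo_pi_div_two hx), Real.cos_neg] at h2 ⊢
  generalize Real.log (2 * Real.cos x) = L at *
  have e : ((L : ℂ) - x * Complex.I) * (L - ((-x : ℝ) : ℂ) * Complex.I) = (x : ℂ) ^ 2 + L ^ 2 := by
    push_cast
    linear_combination -(x : ℂ) ^ 2 * Complex.I_sq
  rw [div_add_div _ _ h1 h2, e]
  push_cast
  ring

theorem integral_div_log_eq_integral_sq_div :
    1 / (2 * Complex.I) * ∫ x in (-(Real.pi / 2))..(Real.pi / 2),
        (x : ℂ) / Complex.log (1 + circlePoint x) =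
      ((∫ x in (0 : ℝ)..(Real.pi / 2),
        x ^ 2 / (x ^ 2 + Real.log (2 * Real.cos x) ^ 2) : ℝ) : ℂ) := by
  have hpi := Real.pi_pos
  have hint : IntervalIntegrable (fun x : ℝ => (x : ℂ) / Complex.log (1 + circlePoint x))
      MeasureTheory.volume (-(Real.pi / 2)) (Real.pi / 2) := by
    simpa using intervalIntegrable_mul_cpow_div_log (b := 0) (by simp)
  have hneg := hint.mono_set (c := -(Real.pi / 2)) (d := 0) (Set.uIcc_subset_uIcc_left
    (Set.mem_uIcc_of_le (by linarith) (by linarith)))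
  have hpos := hint.mono_set (c := 0) (d := Real.pi / 2) (Set.uIcc_subset_uIcc_right
    (Set.mem_uIcc_of_le (by linarith) (by linarith)))
  have hneg' : IntervalIntegrable (fun x : ℝ => ((-x : ℝ) : ℂ) /
      Complex.log (1 + circlePoint (-x))) MeasureTheory.volume 0 (Real.pi / 2) := by
    have := ((IntervalIntegrable.iff_comp_neg (by finiteness)).mp hneg).symm
    simpa using this
  have hcomp := intervalIntegral.integral_comp_neg (a := 0) (b := Real.pi / 2)
    (fun x : ℝ => (x : ℂ) / Complex.log (1 + circlePoint x))
  rw [neg_zero] at hcomp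
  rw [← intervalIntegral.integral_add_adjacent_intervals hneg hpos, ← hcomp, add_comm,
    ← intervalIntegral.integral_add hpos hneg',
    intervalIntegral.integral_congr_Ioo_of_le (by linarith) (fun x hx =>
      div_log_one_add_circlePoint_add_neg ⟨by linarith [hx.1], hx.2⟩),
    intervalIntegral.integral_const_mul, intervalIntegral.integral_ofReal, ← mul_assoc,
    one_div_mul_cancel (by simp), one_mul]

theorem mainTheorem1 :
    (∀ β : ℂ, -1 < β.re →
      IntervalIntegrable
        (fun x : ℝ => (x : ℂ) * (1 + Complex.exp (-2 * Complex.I * x)) ^ β /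
          Complex.log (1 + Complex.exp (-2 * Complex.I * x)))
        MeasureTheory.volume (-(Real.pi / 2)) (Real.pi / 2) ∧
      1 / (2 * Complex.I) *
          ∫ x in (-(Real.pi / 2))..(Real.pi / 2),
            (x : ℂ) * (1 + Complex.exp (-2 * Complex.I * x)) ^ β /
              Complex.log (1 + Complex.exp (-2 * Complex.I * x)) =
        (Real.pi : ℂ) / 8 *
          (1 + (Real.log (2 * Real.pi) : ℂ) - (Real.eulerMascheroniConstant : ℂ) * (2 * β + 1) -
            2 * logGamma (β + 1))) ∧
    (1 / (2 * Complex.I) *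
        ∫ x in (-(Real.pi / 2))..(Real.pi / 2),
          (x : ℂ) / Complex.log (1 + Complex.exp (-2 * Complex.I * x)) =
      ((∫ x in (0 : ℝ)..(Real.pi / 2),
        x ^ 2 / (x ^ 2 + Real.log (2 * Real.cos x) ^ 2) : ℝ) : ℂ)) ∧
    IntervalIntegrable
      (fun x : ℝ => x ^ 2 / (x ^ 2 + Real.log (2 * Real.cos x) ^ 2))
      MeasureTheory.volume 0 (Real.pi / 2) ∧
    4 / Real.pi *
        ∫ x in (0 : ℝ)..(Real.pi / 2), x ^ 2 / (x ^ 2 + Real.log (2 * Real.cos x) ^ 2) =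
      1 / 2 * (1 - Real.eulerMascheroniConstant + Real.log (2 * Real.pi)) := by
  have h3 : 1 / (2 * Complex.I) * ∫ x in (-(Real.pi / 2))..(Real.pi / 2),
      (x : ℂ) / Complex.log (1 + circlePoint x) = (Real.pi : ℂ) / 8 *
        (1 + (Real.log (2 * Real.pi) : ℂ) - (Real.eulerMascheroniConstant : ℂ)) := by
    simpa [logGamma_one] using integral_mul_cpow_div_log (b := 0) (by simp)
  refine ⟨fun b hb => ⟨intervalIntegrable_mul_cpow_div_log hb, integral_mul_cpow_div_log hb⟩,
    integral_div_log_eq_integral_sq_div, intervalIntegrable_sq_div_sq_add_log_sq, ?_⟩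
  rw [integral_div_log_eq_integral_sq_div] at h3
  have h4 : ∫ x in (0 : ℝ)..(Real.pi / 2), x ^ 2 / (x ^ 2 + Real.log (2 * Real.cos x) ^ 2) =
      Real.pi / 8 * (1 + Real.log (2 * Real.pi) - Real.eulerMascheroniConstant) := by
    exact_mod_cast h3
  rw [h4]
  have := Real.pi_ne_zero
  field_simp
  ring
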